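/- Let $(\widetilde M,g)$ be a smooth $n$-dimensional Lorentzian manifold (signature $(-,+,\dots,+)$) with Levi-Civita connection $\widetilde\nabla$, and let $(\widetilde M,g,\xi,\eta,\phi)$ be an $(LCS)_n$-manifold; that is, $\xi$ is a smooth vector field on $\widetilde M$ and $\alpha$ is a nowhere vanishing smooth function on $\widetilde M$ such that, with $\eta(X)=g(X,\xi)$, $$g(\xi,\xi)=-1,\qquad \widetilde\nabla_X\xi=\alpha\{X+\eta(X)\xi\},\qquad d\alpha(X)=\rho\,\eta(X)\ \text{ with }\ \rho=-\xi(\alpha)$$ for all vector fields $X$, and $\phi X=\frac1\alpha\widetilde\nabla_X\xi$. Let $\overline{\widetilde\nabla}$ be the quarter symmetric metric connection on $\widetilde M$, i.e. a linear connection with $\overline{\widetilde\nabla}g=0$ whose torsion is $T(X,Y)=\eta(Y)\phi X-\eta(X)\phi Y$. Let $M$ be an (immersed) submanifold of $\widetilde M$ of dimension $m<n$ which is $C$-totally real, i.e. $\xi$ is normal to $M$ at every point of $M$. Let $\nabla$ and $\overline\nabla$ be the connections induced on $M$ by $\widetilde\nabla$ and $\overline{\widetilde\nabla}$: for $X,Y$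 tangent to $M$, $\nabla_XY$ and $\overline\nabla_XY$ are the components tangent to $M$ of $\widetilde\nabla_XY$ and $\overline{\widetilde\nabla}_XY$. Let $R$ and $\overline R$ be the curvature tensors of $\nabla$ and $\overline\nabla$. For an orthonormal basis $e_1,\dots,e_m$ of $T_xM$ (with respect to the induced metric), let $$\tau(x)=\sum_{1\le i<j\le m}g(R(e_i,e_j)e_j,e_i),\qquad \overline\tau(x)=\sum_{1\le i<j\le m}g(\overline R(e_i,e_j)e_j,e_i)$$ be the scalar curvatures of $M$ at $x$ with respect to $\nabla$ and $\overline\nabla$. Then $\tau(x)=\overline\tau(x)$ for every $x\in M$ and every such basis. -/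

import Mathlib

open Bundle Manifold
open scoped ContDiff Topology

noncomputable section

namespace LCS

/-- The Euclidean model space `ℝⁿ`. -/
abbrev Model (n : ℕ) : Type := EuclideanSpace ℝ (Fin n)

/-- A linear connection on the tangent bundle of an `n`-dimensional manifold.
`D Y x v` is the covariant derivative of the vector field `Y` at `x` in the direction `v`. -/
abbrev Connection (n : ℕ) (N : Type*) [TopologicalSpace N] [ChartedSpace (Model n) N]
    [IsManifold (𝓡 n) ∞ N] : Type _ :=
  CovariantDerivative (𝓡 n) (Model n) (TangentSpace (𝓡 n) : N → Type)

/-- A smooth Lorentzian metric, of signature `(-, +, …, +)`: a smooth field of symmetric bilinear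
forms such that at every point some vector is timelike and the form is positive definite on the
orthogonal complement of that vector. -/
structure LorentzianMetric (n : ℕ) (N : Type*) [TopologicalSpace N] [ChartedSpace (Model n) N]
    [IsManifold (𝓡 n) ∞ N] where
  /-- The bilinear form on each tangent space. -/
  form (x : N) : TangentSpace (𝓡 n) x →L[ℝ] TangentSpace (𝓡 n) x →L[ℝ] ℝ
  symm (x : N) (v w : TangentSpace (𝓡 n) x) : form x v w = form x w v
  lorentzian (x : N) : ∃ t : TangentSpace (𝓡 n) x, form x t t < 0 ∧
    ∀ v : TangentSpace (𝓡 n) x, form x t v = 0 → v ≠ 0 → 0 < form x v v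
  contMDiff : ContMDiff (𝓡 n) ((𝓡 n).prod 𝓘(ℝ, Model n →L[ℝ] Model n →L[ℝ] ℝ)) ∞
    (fun x ↦ TotalSpace.mk' (Model n →L[ℝ] Model n →L[ℝ] ℝ) x (form x))

section Ambient

variable {n : ℕ} {N : Type*} [TopologicalSpace N] [ChartedSpace (Model n) N]
  [IsManifold (𝓡 n) ∞ N]

/-- `D` is a metric connection: `v(g(Y, Z)) = g(D_v Y, Z) + g(Y, D_v Z)`, i.e. `D g = 0`. -/
def IsMetric (g : LorentzianMetric n N) (D : Connection n N) : Prop :=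
  ∀ (x : N) (Y Z : (y : N) → TangentSpace (𝓡 n) y),
    MDifferentiableAt (𝓡 n) ((𝓡 n).prod 𝓘(ℝ, Model n)) (T% Y) x →
    MDifferentiableAt (𝓡 n) ((𝓡 n).prod 𝓘(ℝ, Model n)) (T% Z) x →
    ∀ v : TangentSpace (𝓡 n) x, mvfderiv (𝓡 n) (fun y ↦ g.form y (Y y) (Z y)) x v =
      g.form x (D Y x v) (Z x) + g.form x (Y x) (D Z x v)

/-- `D` is the Levi-Civita connection of `g`: metric and torsion free. -/
structure IsLeviCivita (g : LorentzianMetric n N) (D : Connection n N) : Prop where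
  metric : IsMetric g D
  torsion_eq_zero (x : N) (v w : TangentSpace (𝓡 n) x) : D.torsion x v w = 0

/-- The 1-form `η(X) = g(X, ξ)` associated with the vector field `ξ`. -/
def eta (g : LorentzianMetric n N) (ξ : (x : N) → TangentSpace (𝓡 n) x) (x : N) (v : TangentSpace (𝓡 n) x) : ℝ :=
  g.form x v (ξ x)

/-- The `(1,1)`-tensor field `φ X = (1/α) D_X ξ`. -/
def phi (D : Connection n N) (ξ : (x : N) → TangentSpace (𝓡 n) x) (α : N → ℝ) (x : N) (v : TangentSpace (𝓡 n) x) :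
    TangentSpace (𝓡 n) x :=
  (α x)⁻¹ • D ξ x v

/-- `(g, ξ, α)`, with Levi-Civita connection `D`, is a Lorentzian concircular structure:
`ξ` is a smooth unit timelike vector field with `D_X ξ = α (X + η(X) ξ)` for a smooth nowhere
vanishing function `α` such that `dα = ρ η`, where `ρ = -ξ(α)`. -/
structure IsLCSStructure (g : LorentzianMetric n N) (D : Connection n N)
    (ξ : (x : N) → TangentSpace (𝓡 n) x) (α : N → ℝ) : Prop where
  leviCivita : IsLeviCivita g D
  contMDiff_xi : ContMDiff (𝓡 n) ((𝓡 n).prod 𝓘(ℝ, Model n)) ∞ (T% ξ)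
  contMDiff_alpha : ContMDiff (𝓡 n) 𝓘(ℝ) ∞ α
  unit_timelike (x : N) : g.form x (ξ x) (ξ x) = -1
  alpha_ne_zero (x : N) : α x ≠ 0
  concircular (x : N) (v : TangentSpace (𝓡 n) x) : D ξ x v = α x • (v + eta g ξ x v • ξ x)
  d_alpha (x : N) (v : TangentSpace (𝓡 n) x) :
    mvfderiv (𝓡 n) α x v = -(mvfderiv (𝓡 n) α x (ξ x)) * eta g ξ x v

/-- `D'` is the quarter symmetric metric connection of the Lorentzian concircular structure:
a metric connection whose torsion is `T(X, Y) = η(Y) φ X - η(X) φ Y`. -/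
structure IsQuarterSymmetricMetric (g : LorentzianMetric n N) (D : Connection n N)
    (ξ : (x : N) → TangentSpace (𝓡 n) x) (α : N → ℝ) (D' : Connection n N) : Prop where
  metric : IsMetric g D'
  torsion_eq (x : N) (v w : TangentSpace (𝓡 n) x) :
    D'.torsion x v w = eta g ξ x w • phi D ξ α x v - eta g ξ x v • phi D ξ α x w

end Ambient

section Submanifold

variable {m n : ℕ} {M N : Type*} [TopologicalSpace M] [ChartedSpace (Model m) M]
  [IsManifold (𝓡 m) ∞ M] [TopologicalSpace N] [ChartedSpace (Model n) N] [IsManifold (𝓡 n) ∞ N]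

/-- The differential of `f : M → N` at `x`. -/
abbrev diff (f : M → N) (x : M) : TangentSpace (𝓡 m) x →L[ℝ] TangentSpace (𝓡 n) (f x) :=
  mfderiv (𝓡 m) (𝓡 n) f x

/-- The immersion `f : M → N` is `C`-totally real: `ξ` is normal to `M`. -/
def IsCTotallyReal (g : LorentzianMetric n N) (ξ : (x : N) → TangentSpace (𝓡 n) x) (f : M → N) : Prop :=
  ∀ (x : M) (v : TangentSpace (𝓡 m) x), g.form (f x) (ξ (f x)) (diff f x v) = 0

/-- The functional `v ↦ g(w, df v)` on `T_x M` defined by a vector `w` of `N` at `f x`. -/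
def pairing (g : LorentzianMetric n N) (f : M → N) (x : M) :
    TangentSpace (𝓡 n) (f x) →L[ℝ] TangentSpace (𝓡 m) x →L[ℝ] ℝ :=
  (ContinuousLinearMap.precomp ℝ (diff f x)).comp (g.form (f x))

/-- The induced metric `f^* g` on `M`: `(u, v) ↦ g(df u, df v)`. -/
def inducedMetric (g : LorentzianMetric n N) (f : M → N) (x : M) :
    TangentSpace (𝓡 m) x →L[ℝ] TangentSpace (𝓡 m) x →L[ℝ] ℝ :=
  (pairing g f x).comp (diff f x)

/-- The tangential part of a vector `w` of `N` at `f x`: the vector `u` of `M` at `x` with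
`g(df u, df v) = g(w, df v)` for all `v` tangent to `M` at `x`. (Where the induced metric is
nondegenerate, it is an invertible map `T_x M → (T_x M)^*`, and `w - df u` is normal to `M`.) -/
def tangentialPart (g : LorentzianMetric n N) (f : M → N) (x : M) :
    TangentSpace (𝓡 n) (f x) →L[ℝ] TangentSpace (𝓡 m) x :=
  (inducedMetric g f x).inverse.comp (pairing g f x)

/-- The covariant derivative of a vector field `s` along `f`, for the connection `D` of `N`. In
the coordinate frame `∂_i` of `N` around `f x`, where `s = ∑ sⁱ (∂_i ∘ f)`, it is
`D_v s = ∑ sⁱ(x) D_{df v} ∂_i + ∑ dsⁱ(v) ∂_i`. The field `FiberBundle.extend (Model n) (s x)` is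
`∑ sⁱ(x) ∂_i`, the local extension of `s x` with constant coefficients. -/
def covAlong (D : Connection n N) (f : M → N) (s : (y : M) → TangentSpace (𝓡 n) (f y)) (x : M) :
    TangentSpace (𝓡 m) x →L[ℝ] TangentSpace (𝓡 n) (f x) :=
  (D (FiberBundle.extend (Model n) (s x)) (f x)).comp (diff f x) +
    ((trivializationAt (Model n) (TangentSpace (𝓡 n) : N → Type) (f x)).symmL ℝ (f x)).comp
      (mvfderiv (𝓡 m) (fun y ↦ (trivializationAt (Model n) (TangentSpace (𝓡 n) : N → Type) (f x)
        ⟨f y, s y⟩).2) x)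

/-- The connection induced on `M` by the connection `D` of `N`: `∇_v Y` is the tangential part of
the covariant derivative of `df Y` along `f` (Gauss formula `D_X Y = ∇_X Y + h(X, Y)`). -/
def inducedConnection (g : LorentzianMetric n N) (D : Connection n N) (f : M → N)
    (Y : (y : M) → TangentSpace (𝓡 m) y) (x : M) : TangentSpace (𝓡 m) x →L[ℝ] TangentSpace (𝓡 m) x :=
  (tangentialPart g f x).comp (covAlong D f (fun y ↦ diff f y (Y y)) x)

/-- The curvature `R(X, Y)Z = ∇_X ∇_Y Z - ∇_Y ∇_X Z - ∇_{[X, Y]} Z` on vector fields of `M`. -/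
def curvatureField (cov : ((y : M) → TangentSpace (𝓡 m) y) → (x : M) → TangentSpace (𝓡 m) x →L[ℝ] TangentSpace (𝓡 m) x)
    (X Y Z : (y : M) → TangentSpace (𝓡 m) y) (x : M) : TangentSpace (𝓡 m) x :=
  cov (fun y ↦ cov Z y (Y y)) x (X x) - cov (fun y ↦ cov Z y (X y)) x (Y x) -
    cov Z x (VectorField.mlieBracket (𝓡 m) X Y x)

/-- The curvature tensor `R(u, v)w` at a point, computed with local smooth extensions of
`u`, `v`, `w`. -/
def curvature (cov : ((y : M) → TangentSpace (𝓡 m) y) → (x : M) → TangentSpace (𝓡 m) x →L[ℝ] TangentSpace (𝓡 m) x)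
    (x : M) (u v w : TangentSpace (𝓡 m) x) : TangentSpace (𝓡 m) x :=
  curvatureField cov (FiberBundle.extend (Model m) u) (FiberBundle.extend (Model m) v)
    (FiberBundle.extend (Model m) w) x

/-- The sectional curvature of the plane spanned by `u`, `v`, for the connection `cov` and the
scalar product `b` on `T_x M`:
`K(u, v) = b(R(u, v)v, u) / (b(u, u) b(v, v) - b(u, v)²)`. -/
def sectionalCurvature (cov : ((y : M) → TangentSpace (𝓡 m) y) → (x : M) → TangentSpace (𝓡 m) x →L[ℝ] TangentSpace (𝓡 m) x)
    (x : M) (b : TangentSpace (𝓡 m) x →L[ℝ] TangentSpace (𝓡 m) x →L[ℝ] ℝ) (u v : TangentSpace (𝓡 m) x) : ℝ :=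
  b (curvature cov x u v v) u / (b u u * b v v - b u v ^ 2)

/-- `e₁, …, e_m` is an orthonormal basis of `T_x M` for the scalar product `b`. -/
def IsOrthonormalBasis (x : M) (b : TangentSpace (𝓡 m) x →L[ℝ] TangentSpace (𝓡 m) x →L[ℝ] ℝ) (e : Fin m → TangentSpace (𝓡 m) x) : Prop :=
  ∀ i j, b (e i) (e j) = if i = j then 1 else 0

/-- The scalar curvature `τ = ∑_{i < j} K(e_i, e_j)` of `M` at `x`, computed in the orthonormal
basis `e` of `T_x M`. -/
def scalarCurvature (cov : ((y : M) → TangentSpace (𝓡 m) y) → (x : M) → TangentSpace (𝓡 m) x →L[ℝ] TangentSpace (𝓡 m) x)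
    (x : M) (b : TangentSpace (𝓡 m) x →L[ℝ] TangentSpace (𝓡 m) x →L[ℝ] ℝ) (e : Fin m → TangentSpace (𝓡 m) x) : ℝ :=
  ∑ i, ∑ j ∈ Finset.Ioi i, sectionalCurvature cov x b (e i) (e j)

end Submanifold

end LCS

end

namespace LCS

open FiberBundle

section Ambient

variable {n : ℕ} {N : Type*} [TopologicalSpace N] [ChartedSpace (Model n) N]
  [IsManifold (𝓡 n) ∞ N]

/-! The stronger fact behind the equality is that both connections induce the same connection on
$M$. A metric connection is determined by its torsion: `IsMetric.two_mul_form_sub` expresses $A = D'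
- D$ algebraically through the difference of torsions. Each term of the quarter symmetric torsion
has a factor $\eta$ of one of its arguments, and $\eta$ vanishes on vectors tangent to $M$. Hence
$A(u,v)$ is normal to $M$ for tangent $u$, $v$, the tangential parts agree, and so do all
curvatures. -/

/-- The difference of two metric connections is skew-symmetric in its last two slots. -/
theorem IsMetric.form_sub_add_form_sub {g : LorentzianMetric n N} {D D' : Connection n N}
    (hD : IsMetric g D) (hD' : IsMetric g D') (x : N) (u v w : TangentSpace (𝓡 n) x) :
    g.form x (D' (extend (Model n) v) x u - D (extend (Model n) v) x u) w +
      g.form x (D' (extend (Model n) w) x u - D (extend (Model n) w) x u) v = 0 := by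
  have hv := mdifferentiableAt_extend (𝓡 n) (Model n) v
  have hw := mdifferentiableAt_extend (𝓡 n) (Model n) w
  have h := hD x _ _ hv hw u
  have h' := hD' x _ _ hv hw u
  simp only [extend_apply_self] at h h'
  rw [g.symm x v] at h h'
  simp only [map_sub, sub_apply]
  -- Both metric identities have the same left side, the derivative of $g(V,W)$ along $u$;
  -- subtracting them leaves the claim.
  linarith

/-- The antisymmetrization of the difference of two connections is the difference of their
torsions. -/
theorem sub_sub_sub_eq_torsion_sub (D D' : Connection n N) (x : N)
    (u v : TangentSpace (𝓡 n) x) :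
    (D' (extend (Model n) v) x u - D (extend (Model n) v) x u) -
      (D' (extend (Model n) u) x v - D (extend (Model n) u) x v) =
      D'.torsion x u v - D.torsion x u v := by
  -- The Lie bracket of the two extensions is common to both torsions and cancels.
  simp only [CovariantDerivative.torsion_apply_eq_extend, extend_apply_self]
  abel

/-- The Koszul formula for the difference of two metric connections in terms of their torsions. -/
theorem IsMetric.two_mul_form_sub {g : LorentzianMetric n N} {D D' : Connection n N}
    (hD : IsMetric g D) (hD' : IsMetric g D') (x : N) (u v w : TangentSpace (𝓡 n) x) :
    2 * g.form x (D' (extend (Model n) v) x u - D (extend (Model n) v) x u) w =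
      g.form x (D'.torsion x u v - D.torsion x u v) w -
        g.form x (D'.torsion x v w - D.torsion x v w) u +
        g.form x (D'.torsion x w u - D.torsion x w u) v := by
  -- Only outer differences are split, so that the values $g(A(u,v),w)$ stay atoms. Skewness in the
  -- last two slots, for the three cyclic orders, then reduces the six terms to $2g(A(u,v),w)$.
  simp only [← sub_sub_sub_eq_torsion_sub, map_sub (g.form x) (_ - _) (_ - _),
    sub_apply]
  linarith [hD.form_sub_add_form_sub hD' x u v w, hD.form_sub_add_form_sub hD' x v w u,
    hD.form_sub_add_form_sub hD' x w u v]

/-- On vectors orthogonal to `ξ`, the quarter symmetric metric connection and the Levi-Civita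
connection differ by vectors orthogonal to all vectors orthogonal to `ξ`. -/
theorem IsQuarterSymmetricMetric.form_eq_of_eta_eq_zero {g : LorentzianMetric n N}
    {D D' : Connection n N} {ξ : (x : N) → TangentSpace (𝓡 n) x} {α : N → ℝ}
    (hD : IsLeviCivita g D) (hD' : IsQuarterSymmetricMetric g D ξ α D') {x : N}
    {u v w : TangentSpace (𝓡 n) x} (hu : eta g ξ x u = 0) (hv : eta g ξ x v = 0)
    (hw : eta g ξ x w = 0) :
    g.form x (D (extend (Model n) v) x u) w = g.form x (D' (extend (Model n) v) x u) w := by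
  have h := hD.metric.two_mul_form_sub hD'.metric x u v w
  simp only [hD.torsion_eq_zero, hD'.torsion_eq, hu, hv, hw, zero_smul, sub_zero, map_zero,
    zero_apply, add_zero] at h
  rw [map_sub, sub_apply] at h
  linarith

end Ambient

section Submanifold

variable {m n : ℕ} {M N : Type*} [TopologicalSpace M] [ChartedSpace (Model m) M]
  [TopologicalSpace N] [ChartedSpace (Model n) N] [IsManifold (𝓡 n) ∞ N]

/-- On a `C`-totally real submanifold, the Levi-Civita connection and the quarter symmetric metric
connection induce the same connection. -/
theorem inducedConnection_eq_of_isCTotallyReal {g : LorentzianMetric n N}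
    {D D' : Connection n N} {ξ : (x : N) → TangentSpace (𝓡 n) x} {α : N → ℝ}
    (hD : IsLeviCivita g D) (hD' : IsQuarterSymmetricMetric g D ξ α D') {f : M → N}
    (hξ : IsCTotallyReal (m := m) g ξ f) :
    inducedConnection (m := m) g D f = inducedConnection g D' f := by
  have heta (x : M) (v : TangentSpace (𝓡 m) x) : eta g ξ (f x) (diff f x v) = 0 :=
    (g.symm _ _ _).trans (hξ x v)
  funext Y x
  ext1 u
  -- The tangential part of a vector depends only on its products with the vectors $df\,w$.
  have hpair : pairing (m := m) g f x (covAlong D f (fun y ↦ diff f y (Y y)) x u) =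
      pairing g f x (covAlong D' f (fun y ↦ diff f y (Y y)) x u) := by
    ext1 w
    simp only [pairing, covAlong, ContinuousLinearMap.comp_apply, add_apply,
      map_add]
    -- The summand differentiating the coefficients of $df\,Y$ does not involve the connection; only
    -- the derivative of the constant-coefficient extension has to be compared.
    exact congrArg (· + _)
      (hD'.form_eq_of_eta_eq_zero hD (heta x u) (heta x (Y x)) (heta x w))
  -- Equal functionals have equal images under `inverse`, so nondegeneracy of the induced metric is
  -- not needed here.
  exact congrArg (inducedMetric g f x).inverse hpair

end Submanifold

end LCS

theorem theorem3p3 {m n : ℕ} (hmn : m < n)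
    {N : Type*} [TopologicalSpace N] [T2Space N] [SecondCountableTopology N]
    [ChartedSpace (LCS.Model n) N] [IsManifold (𝓡 n) ∞ N]
    {M : Type*} [TopologicalSpace M] [T2Space M] [SecondCountableTopology M]
    [ChartedSpace (LCS.Model m) M] [IsManifold (𝓡 m) ∞ M]
    (g : LCS.LorentzianMetric n N) (D : LCS.Connection n N)
    (ξ : (x : N) → TangentSpace (𝓡 n) x) (α : N → ℝ) (hLCS : LCS.IsLCSStructure g D ξ α)
    (D' : LCS.Connection n N) (hD' : LCS.IsQuarterSymmetricMetric g D ξ α D')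
    (f : M → N) (hf : IsImmersion (𝓡 m) (𝓡 n) ∞ f) (hξ : LCS.IsCTotallyReal (m := m) g ξ f)
    (x : M) (e : Fin m → TangentSpace (𝓡 m) x)
    (he : LCS.IsOrthonormalBasis x (LCS.inducedMetric g f x) e) :
    LCS.scalarCurvature (LCS.inducedConnection g D f) x (LCS.inducedMetric g f x) e =
      LCS.scalarCurvature (LCS.inducedConnection g D' f) x (LCS.inducedMetric g f x) e := by
  rw [LCS.inducedConnection_eq_of_isCTotallyReal hLCS.leviCivita hD' hξ]
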